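/- Let $M$ be a finite band monoid (a finite monoid in which every element is idempotent) and let $k$ be a field. Let $\Lambda(M)$ be the support lattice of $M$, i.e. the set of principal two-sided ideals $X$ of $M$ such that $M_X=\{m\in M\mid X\subseteq MmM\}$ is a submonoid, ordered by inclusion (for a band these are all the principal ideals), and let $\sigma\colon M\to\Lambda(M)$, $\sigma(m)=MmM$, be the support map. For $X\in\Lambda(M)$ let $S_X$ be the one-dimensional $kM$-module on which $m\in M$ acts as $1$ if $\sigma(m)\geq X$ and as $0$ otherwise. For a finite dimensional $k$-algebra $A$ that splits over $k$ (that is, $A/\mathrm{rad}(A)$ is a product of matrix algebras over $k$), the quiver $Q(A)$ is the directed graph whose vertices are the isomorphism classes of simple left $A$-modules and in which the number of arrows from $S$ to $T$ is $\dim_k \mathrm{Ext}^1_A(S,T)$. Write $L_m=\{n\in M\mid Mn=Mm\}$, and for idempotents write $e<f$ if $ef=e=fe$ and $e\neq f$. Then $kM$ splits over $k$, and $X\mapsto [S_X]$ is a bijection from $\Lambda(M)$ to the vertex set of $Q(kM)$. Identify the two sets by this bijection. For $X,Y\in\Lambda(M)$ the following hold. 1. If $X,Y$ are incomparable or $X=Y$,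 then there are no arrows from $X$ to $Y$ in $Q(kM)$. 2. If $X<Y$, then for every generator $e_Y$ of $Y$ (at least one exists) there is a generator $e_X$ of $X$ with $e_X<e_Y$. For any generators $e_X,e_Y$ of $X,Y$ with $e_X<e_Y$, let $\equiv$ be the smallest equivalence relation on $e_YL_{e_X}$ such that: (a) $e_Ymx\equiv e_Yme_Yx$ for all $x\in L_{e_X}$ and $m\in M$ with $\sigma(m)\geq X$; (b) $x\equiv x'$ whenever $x,x'\in e_YL_{e_X}$ and there exists $e\in e_YMe_Y\setminus\{e_Y\}$ with $X<\sigma(e)$, $ex=x$ and $ex'=x'$. Then the number of arrows from $X$ to $Y$ in $Q(kM)$ is $|e_YL_{e_X}/{\equiv}|-1$. 3. If $Y<X$, then the number of arrows from $X$ to $Y$ in $Q(kM)$ equals the number of arrows from $Y$ to $X$ in $Q(kM^{op})$ (where $X$ and $Y$ are regarded as elements of $\Lambda(M^{op})$, these being the same subsets of $M$), and hence, for any generators $e_X,e_Y$ of $X,Y$ with $e_Y<e_X$, it is the number given by the formula in part 2 applied to the monoid $M^{op}$ and the pair $Y<X$ with generators $e_Y<e_X$. -/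

import Mathlib

open CategoryTheory

universe u v

namespace BandQuiver

/-! ### Ideals of a monoid and the support lattice -/

section Ideals

variable {M : Type u} [Monoid M]

/-- The principal two-sided ideal `M m M`. -/
def principalIdeal (m : M) : Set M := {x | ∃ a b : M, x = a * m * b}

/-- Two-sided ideals of a monoid; the empty set is allowed. -/
def IsIdeal (I : Set M) : Prop := ∀ x ∈ I, ∀ m : M, m * x ∈ I ∧ x * m ∈ I

/-- An ideal is prime if its complement is a submonoid. -/
def IsPrimeIdeal (P : Set M) : Prop :=
  IsIdeal P ∧ (1 : M) ∉ P ∧ ∀ m n : M, m ∉ P → n ∉ P → m * n ∉ P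

/-- `nup X` is the set of all `m` with `X ⊈ M m M`. -/
def nup (X : Set M) : Set M := {m | ¬ X ⊆ principalIdeal m}

/-- A principal ideal `X` is primary if `nup X` is a prime ideal. -/
def IsPrimary (X : Set M) : Prop :=
  (∃ m : M, X = principalIdeal m) ∧ IsPrimeIdeal (nup X)

variable (M) in
/-- The support lattice `Λ(M)`: the primary ideals of `M`, ordered by inclusion. -/
abbrev SupportLattice : Type u := {X : Set M // IsPrimary X}

/-- The `𝓛`-class of `m`: all `n` with `M n = M m`. -/
def LClass (m : M) : Set M :=
  {n | (Set.range fun a : M => a * n) = Set.range fun a : M => a * m}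

/-- The strict natural order on idempotents: `e < f` iff `e f = e = f e` and `e ≠ f`. -/
def IdemLT (e f : M) : Prop := e * f = e ∧ f * e = e ∧ e ≠ f

theorem principalIdeal_mul_left (a m : M) : principalIdeal (a * m) ⊆ principalIdeal m := by
  rintro x ⟨c, d, rfl⟩
  exact ⟨c * a, d, by simp only [mul_assoc]⟩

theorem principalIdeal_mul_right (m a : M) : principalIdeal (m * a) ⊆ principalIdeal m := by
  rintro x ⟨c, d, rfl⟩
  exact ⟨c, a * d, by simp only [mul_assoc]⟩

theorem mem_principalIdeal_self (m : M) : m ∈ principalIdeal m := ⟨1, 1, by simp⟩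

theorem principalIdeal_subset {x m : M} (h : x ∈ principalIdeal m) :
    principalIdeal x ⊆ principalIdeal m := by
  obtain ⟨a, b, rfl⟩ := h
  exact (principalIdeal_mul_right _ _).trans (principalIdeal_mul_left _ _)

theorem isIdeal_nup (X : Set M) : IsIdeal (nup X) := fun x hx m =>
  ⟨fun h => hx (h.trans (principalIdeal_mul_left m x)),
    fun h => hx (h.trans (principalIdeal_mul_right x m))⟩

theorem principalIdeal_op (m : M) :
    principalIdeal (MulOpposite.op m) = MulOpposite.unop ⁻¹' principalIdeal m := by
  ext x
  constructor
  · rintro ⟨a, b, rfl⟩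
    exact ⟨b.unop, a.unop, by simp [mul_assoc]⟩
  · rintro ⟨a, b, h⟩
    refine ⟨MulOpposite.op b, MulOpposite.op a, MulOpposite.unop_injective ?_⟩
    simpa [mul_assoc] using h

theorem op_mem_nup_iff (X : Set M) (m : M) :
    MulOpposite.op m ∈ nup (MulOpposite.unop ⁻¹' X) ↔ m ∈ nup X := by
  simp only [nup, Set.mem_ofPred_eq, principalIdeal_op]
  rw [Set.preimage_subset_preimage_iff]
  exact fun x _ => ⟨MulOpposite.op x, rfl⟩

/-- A primary ideal of `M`, as a primary ideal of the opposite monoid (the same set). -/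
def SupportLattice.op (X : SupportLattice M) : SupportLattice Mᵐᵒᵖ :=
  ⟨MulOpposite.unop ⁻¹' X.1, by
    obtain ⟨⟨m, hm⟩, -, h1, hmul⟩ := X.2
    refine ⟨⟨MulOpposite.op m, by rw [principalIdeal_op, hm]⟩, isIdeal_nup _, ?_, ?_⟩
    · exact fun h => h1 ((op_mem_nup_iff X.1 1).1 h)
    · intro a b ha hb h
      refine hmul b.unop a.unop ?_ ?_ ((op_mem_nup_iff X.1 (b.unop * a.unop)).1 h)
      · exact fun hb' => hb ((op_mem_nup_iff X.1 b.unop).2 hb')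
      · exact fun ha' => ha ((op_mem_nup_iff X.1 a.unop).2 ha')⟩

end Ideals

/-! ### Bands -/

/-- A monoid is a band if all of its elements are idempotent. -/
class IsBand (M : Type u) [Monoid M] : Prop where
  mul_self : ∀ m : M, m * m = m

instance {M : Type u} [Monoid M] [IsBand M] : IsBand Mᵐᵒᵖ :=
  ⟨fun m => MulOpposite.unop_injective (IsBand.mul_self m.unop)⟩

section Band

variable {M : Type u} [Monoid M] [IsBand M]

theorem principalIdeal_comm (m n : M) : principalIdeal (m * n) ⊆ principalIdeal (n * m) := by
  apply principalIdeal_subset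
  refine ⟨m, n, ?_⟩
  rw [← IsBand.mul_self (m * n)]
  simp only [mul_assoc]

theorem isPrimary_principalIdeal (x : M) : IsPrimary (principalIdeal x) := by
  refine ⟨⟨x, rfl⟩, isIdeal_nup _, fun h => h ?_, fun m n hm hn h => h ?_⟩
  · rintro y -
    exact ⟨y, 1, by simp⟩
  · obtain ⟨a, b, h1⟩ := not_not.1 hm (mem_principalIdeal_self x)
    obtain ⟨c, d, h2⟩ := not_not.1 hn (mem_principalIdeal_self x)
    have h3 : x = c * (n * (d * a * m)) * b := by
      calc x = (c * n * d) * (a * m * b) := by rw [← h1, ← h2, IsBand.mul_self]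
        _ = _ := by simp only [mul_assoc]
    refine principalIdeal_subset ?_
    have h4 : x ∈ principalIdeal (n * (d * a * m)) := ⟨c, b, h3⟩
    have h5 := principalIdeal_comm _ _ h4
    rw [mul_assoc] at h5
    exact principalIdeal_mul_left _ _ h5

/-- The support map `σ : M → Λ(M)` of a band, `σ(m) = M m M`. -/
def support (m : M) : SupportLattice M := ⟨principalIdeal m, isPrimary_principalIdeal m⟩

/-- `σ(m)` is the largest primary ideal contained in `M m M`. -/
theorem support_isGreatest (m : M) :
    IsGreatest {P : SupportLattice M | (P : Set M) ⊆ principalIdeal m} (support m) :=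
  ⟨fun _ h => h, fun _ hP => hP⟩

/-- The set `e_Y L_{e_X}`. -/
def translatedLClass (eX eY : M) : Set M := {z | ∃ x ∈ LClass eX, z = eY * x}

/-- The pairs that generate the equivalence relation on `e_Y L_{e_X}`, `X = M e_X M`:
either `(e_Y m x, e_Y m e_Y x)` with `x ∈ L_{e_X}` and `σ(m) ≥ X`, or a pair `(x, x')` with
`e x = x` and `e x' = x'` for some `e ∈ e_Y M e_Y \ {e_Y}` with `X < σ(e)`. -/
def generatingRel (eX eY : M) (z z' : translatedLClass eX eY) : Prop :=
  (∃ m x : M, x ∈ LClass eX ∧ support eX ≤ support m ∧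
    (z : M) = eY * m * x ∧ (z' : M) = eY * m * eY * x) ∨
  (∃ e : M, (∃ m : M, e = eY * m * eY) ∧ e ≠ eY ∧ support eX < support e ∧
    e * z = z ∧ e * z' = z')

/-- The quotient of `e_Y L_{e_X}` by the smallest equivalence relation `≡` containing the
generating pairs. -/
def EquivClasses (eX eY : M) : Type u :=
  Quotient (Relation.EqvGen.setoid (generatingRel eX eY))

end Band

/-! ### The quiver of a finite dimensional algebra -/

section Quiver

/-- A `k`-algebra `A` splits over `k` if `A / rad A` is isomorphic to a finite product of matrix
algebras over `k`. -/
def IsSplitAlgebra (k : Type v) [Field k] (A : Type u) [Ring A] [Algebra k A] : Prop :=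
  ∃ (n : ℕ) (d : Fin n → ℕ), (∀ i, 0 < d i) ∧
    Nonempty ((A ⧸ Ring.jacobson A) ≃ₐ[k] ((i : Fin n) → Matrix (Fin (d i)) (Fin (d i)) k))

/-- Isomorphism of simple left `A`-modules. -/
def simpleSetoid (A : Type u) [Ring A] : Setoid {S : ModuleCat.{u} A // Simple S} :=
  (isIsomorphicSetoid (ModuleCat.{u} A)).comap Subtype.val

/-- The vertex set of the (Gabriel) quiver `Q(A)` of the `k`-algebra `A`: the isomorphism classes
of simple left `A`-modules. -/
def GabrielQuiver (k : Type v) [Field k] (A : Type u) [Ring A] [Algebra k A] : Type (u + 1) :=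
  Quotient (simpleSetoid A)

/-- The arrows of `Q(A)` from `S` to `T` are the elements of a basis of the `k`-vector space
`Ext¹_A(S, T)`, so that their number is `dim_k Ext¹_A(S, T)`. -/
noncomputable instance (k : Type v) [Field k] (A : Type u) [Ring A] [Algebra k A] :
    Quiver.{u} (GabrielQuiver k A) where
  Hom S T := Module.Basis.ofVectorSpaceIndex k (Abelian.Ext.{u} S.out.1 T.out.1 1)

end Quiver

/-! ### The simple modules attached to the primary ideals -/

section SimpleModules

variable {M : Type u} [Monoid M]

open Classical in
/-- The character `M → k` with value `1` at `m` if `X ⊆ M m M`, and `0` otherwise. -/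
noncomputable def supportChar (k : Type v) [Field k] (X : SupportLattice M) : M →* k where
  toFun m := if m ∈ nup X.1 then 0 else 1
  map_one' := if_neg X.2.2.2.1
  map_mul' m n := by
    obtain ⟨-, hI, -, hmul⟩ := X.2
    by_cases hm : m ∈ nup X.1
    · simp [hm, (hI m hm n).2]
    · by_cases hn : n ∈ nup X.1
      · simp [hn, (hI n hn m).1]
      · simp [hm, hn, hmul m n hm hn]

/-- The one-dimensional `kM`-module `S_X` on which `m ∈ M` acts through `supportChar k X`. -/
noncomputable def supportModule (k : Type v) [Field k] (X : SupportLattice M) :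
    ModuleCat.{max u v} (MonoidAlgebra k M) :=
  (ModuleCat.restrictScalars (MonoidAlgebra.lift k k M (supportChar k X)).toRingHom).obj
    (ModuleCat.of k (ULift.{u} k))

theorem supportModule_simple (k : Type v) [Field k] (X : SupportLattice M) :
    Simple (supportModule k X) := by
  rw [simple_iff_isSimpleModule', isSimpleModule_iff_toSpanSingleton_surjective]
  constructor
  · exact inferInstanceAs (Nontrivial (ULift.{u} k))
  · intro x hx y
    obtain ⟨x⟩ := (x : ULift.{u} k)
    obtain ⟨y⟩ := (y : ULift.{u} k)
    have hx0 : x ≠ 0 := fun h => hx (by subst h; rfl)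
    refine ⟨algebraMap k _ (y / x), ?_⟩
    change ULift.up ((MonoidAlgebra.lift k k M (supportChar k X)) (algebraMap k _ (y / x)) * x) =
      ULift.up y
    rw [AlgHom.commutes]
    simp [hx0]

/-- The vertex of `Q(kM)` attached to `X ∈ Λ(M)`: the isomorphism class of `S_X`. -/
noncomputable def vertex (k : Type v) [Field k] (X : SupportLattice M) :
    GabrielQuiver k (MonoidAlgebra k M) :=
  Quotient.mk (simpleSetoid (MonoidAlgebra k M)) ⟨supportModule k X, supportModule_simple k X⟩

end SimpleModules

end BandQuiver

open BandQuiver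

universe w

/-! Write χ, ψ for the characters of X, Y. Applying Hom(-, S_Y) to 0 → K → kM → S_X → 0 turns
Ext¹(S_X, S_Y) into Hom(K, S_Y) modulo the maps that extend to kM. The elements m - χ(m) span K, so
such a map is a function d : M → k with d(mn) = ψ(m)d(n) + d(m)χ(n), and the extendable ones are the
multiples of ψ - χ (`mk_arrows`, via `ker_derivationExt`).

It remains to find these derivations on a band. Idempotence forces d(m) = 0 whenever χ(m) = ψ(m).
This makes every derivation inner when X and Y are equal or incomparable. If X < Y, then d is
determined by its values on e_Y L_{e_X}, and the derivation rule says exactly that those values are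
constant on the classes of ≡ (`charDerivationsEquiv`); the inner derivations form a line, which
accounts for the -1. If Y < X, passing to the opposite monoid swaps the characters.

Simple modules are found by choosing x of minimal support that does not annihilate S: it forces S to
be one-dimensional with the character of σ(x). Splitting follows because the characters jointly map
kM onto a power of k, with kernel the radical. -/

namespace BandQuiver

/-! ### Supports, 𝓛-classes and characters of a band. -/

section BandLemmas

variable {M : Type u} [Monoid M] [IsBand M]

theorem principalIdeal_subset_mul {x a b : M} (ha : principalIdeal x ⊆ principalIdeal a)
    (hb : principalIdeal x ⊆ principalIdeal b) : principalIdeal x ⊆ principalIdeal (a * b) :=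
  not_not.1 ((isPrimary_principalIdeal x).2.2.2 a b (not_not.2 ha) (not_not.2 hb))

/-- By primality x lies in the ideal of y = xmx, so p y q = x for some p, q in the local monoid xMx.
There a one-sided invertible idempotent is the identity x: this applies first to p, then to y. The
resulting equation makes comparison of supports a computation with elements. -/
theorem mul_mul_self_of_subset {x m : M} (h : principalIdeal x ⊆ principalIdeal m) :
    x * m * x = x := by
  have hx := subset_refl (principalIdeal x)
  obtain ⟨c, d, hcd⟩ := principalIdeal_subset_mul (principalIdeal_subset_mul hx h) hx
    (mem_principalIdeal_self x)
  have hxx := IsBand.mul_self x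
  set y := x * m * x with hy
  have hxy : x * y = y := by simp only [hy, ← mul_assoc, hxx]
  have hyx : y * x = y := by simp only [hy, mul_assoc, hxx]
  have hyy := IsBand.mul_self y
  -- in the monoid `x M x`, the element `y` has the left factor `x c x` and right factor `x d x`
  have h1 : (x * c * x) * y * (x * d * x) = x := by
    calc (x * c * x) * y * (x * d * x) = x * c * (x * y * x) * d * x := by simp only [mul_assoc]
      _ = x * (c * y * d) * x := by rw [hxy, hyx]; simp only [mul_assoc]
      _ = x := by rw [← hcd, hxx, hxx]
  have hp : x * c * x = x := by
    have hpp := IsBand.mul_self (x * c * x)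
    have hpx : x * c * x * x = x * c * x := by rw [mul_assoc _ x x, hxx]
    generalize x * c * x = p at h1 hpp hpx ⊢
    calc p = p * (p * y * (x * d * x)) := by rw [h1, hpx]
      _ = p * p * y * (x * d * x) := by simp only [mul_assoc]
      _ = x := by rw [hpp, h1]
  have hyq : y * (x * d * x) = x := by rw [hp, hxy] at h1; exact h1
  rw [← hyx]
  nth_rewrite 1 [← hyq]
  rw [← mul_assoc y y, hyy, hyq]

theorem subset_iff_mul_mul_self {x m : M} :
    principalIdeal x ⊆ principalIdeal m ↔ x * m * x = x :=
  ⟨mul_mul_self_of_subset, fun h => principalIdeal_subset ⟨x, x, h.symm⟩⟩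

theorem support_le_support_iff {x m : M} : support x ≤ support m ↔ x * m * x = x :=
  subset_iff_mul_mul_self

theorem mul_mul_mul_of_mul_mul_self {x m n : M} (hm : x * m * x = x) (hn : x * n * x = x) :
    x * (m * n) * x = x :=
  mul_mul_self_of_subset (principalIdeal_subset_mul (subset_iff_mul_mul_self.2 hm)
    (subset_iff_mul_mul_self.2 hn))

theorem mul_mul_left_of_mul_mul {x m n : M} (h : x * (m * n) * x = x) : x * m * x = x :=
  mul_mul_self_of_subset ((subset_iff_mul_mul_self.2 h).trans (principalIdeal_mul_right m n))

theorem mul_mul_right_of_mul_mul {x m n : M} (h : x * (m * n) * x = x) : x * n * x = x :=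
  mul_mul_self_of_subset ((subset_iff_mul_mul_self.2 h).trans (principalIdeal_mul_left m n))

theorem exists_support_eq (X : SupportLattice M) : ∃ e : M, support e = X := by
  obtain ⟨m, hm⟩ := X.2.1
  exact ⟨m, Subtype.ext hm.symm⟩

theorem mem_LClass_iff {n e : M} : n ∈ LClass e ↔ n * e = n ∧ e * n = e := by
  constructor
  · intro h
    have h' : (Set.range fun a : M => a * n) = Set.range fun a : M => a * e := h
    obtain ⟨a, ha⟩ : n ∈ Set.range fun a : M => a * e := h' ▸ ⟨1, one_mul n⟩
    obtain ⟨b, hb⟩ : e ∈ Set.range fun a : M => a * n := h' ▸ ⟨1, one_mul e⟩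
    simp only at ha hb
    constructor
    · rw [← ha, mul_assoc, IsBand.mul_self]
    · nth_rewrite 1 [← hb]
      rw [mul_assoc, IsBand.mul_self, hb]
  · rintro ⟨h1, h2⟩
    refine Set.Subset.antisymm ?_ ?_
    · rintro _ ⟨a, rfl⟩
      exact ⟨a * n, by simp only [mul_assoc, h1]⟩
    · rintro _ ⟨a, rfl⟩
      exact ⟨a * e, by simp only [mul_assoc, h2]⟩

theorem exists_idemLT {X : SupportLattice M} {eY : M} (h : X < support eY) :
    ∃ eX : M, support eX = X ∧ IdemLT eX eY := by
  obtain ⟨x, rfl⟩ := exists_support_eq X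
  have hx := support_le_support_iff.1 h.le
  -- Compressing any generator x by e_Y puts it below e_Y; primality keeps its support from
  -- dropping.
  have hs : support (eY * x * eY) = support x := by
    refine le_antisymm ?_ ?_
    · exact (principalIdeal_mul_right _ _).trans (principalIdeal_mul_left _ _)
    · exact principalIdeal_subset_mul (principalIdeal_subset_mul h.le subset_rfl) h.le
  refine ⟨eY * x * eY, hs, ?_, ?_, ?_⟩
  · rw [mul_assoc, IsBand.mul_self]
  · rw [← mul_assoc, ← mul_assoc, IsBand.mul_self]
  · intro he
    rw [he] at hs
    exact h.ne hs.symm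

open Classical in
theorem supportChar_support (k : Type v) [Field k] (x m : M) :
    supportChar k (support x) m = if x * m * x = x then 1 else 0 := by
  change (if m ∈ nup (principalIdeal x) then (0 : k) else 1) = _
  have : m ∈ nup (principalIdeal x) ↔ ¬ x * m * x = x := not_congr subset_iff_mul_mul_self
  by_cases h : x * m * x = x <;> simp [this, h]

theorem supportChar_eq_one {k : Type v} [Field k] {x m : M} (h : x * m * x = x) :
    supportChar k (support x) m = 1 := by
  rw [supportChar_support, if_pos h]

theorem supportChar_eq_zero {k : Type v} [Field k] {x m : M} (h : x * m * x ≠ x) :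
    supportChar k (support x) m = 0 := by
  rw [supportChar_support, if_neg h]

theorem supportChar_injective (k : Type v) [Field k] :
    Function.Injective (supportChar k : SupportLattice M → M →* k) := by
  have key : ∀ x y : M, supportChar k (support x) = supportChar k (support y) →
      support y ≤ support x := by
    intro x y h
    rw [support_le_support_iff]
    by_contra hn
    have h1 := supportChar_eq_zero (k := k) hn
    rw [← h, supportChar_eq_one (by rw [IsBand.mul_self, IsBand.mul_self])] at h1
    exact one_ne_zero h1
  intro X Y h
  obtain ⟨x, rfl⟩ := exists_support_eq X
  obtain ⟨y, rfl⟩ := exists_support_eq Y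
  exact le_antisymm (key y x h.symm) (key x y h)

end BandLemmas

/-! ### Derivations with respect to a pair of characters. -/

section Derivations

variable {M : Type u} [Monoid M] {k : Type v} [Field k]

/-- The derivations `d : M → k` with respect to two characters: `d (m n) = ψ(m) d(n) + d(m) χ(n)`. -/
def charDerivations (χ ψ : M →* k) : Submodule k (M → k) where
  carrier := {d | ∀ m n, d (m * n) = ψ m * d n + d m * χ n}
  zero_mem' := fun m n => by simp
  add_mem' := fun {d d'} hd hd' m n => by
    simp only [Pi.add_apply]
    rw [hd m n, hd' m n]
    ring
  smul_mem' := fun c d hd m n => by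
    simp only [Pi.smul_apply, smul_eq_mul]
    rw [hd m n]
    ring

/-- The inner derivations, the multiples of `ψ - χ`. -/
def innerDerivations (χ ψ : M →* k) : Submodule k (M → k) := k ∙ fun m => ψ m - χ m

theorem innerDerivations_le (χ ψ : M →* k) : innerDerivations χ ψ ≤ charDerivations χ ψ := by
  refine (Submodule.span_singleton_le_iff_mem _ _).2 fun m n => ?_
  simp only [map_mul]
  ring

/-- Derivations modulo inner derivations. -/
abbrev DerivationClasses (χ ψ : M →* k) : Type (max u v) :=
  charDerivations χ ψ ⧸ (innerDerivations χ ψ).submoduleOf (charDerivations χ ψ)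

variable {χ ψ : M →* k} {d : M → k}

theorem charDerivations_apply_eq_zero_of_eq_one [IsBand M] (hd : d ∈ charDerivations χ ψ) {m : M}
    (h1 : χ m = 1) (h2 : ψ m = 1) : d m = 0 := by
  have h := hd m m
  rw [IsBand.mul_self, h1, h2] at h
  linear_combination -h

theorem charDerivations_apply_eq_zero_of_eq_zero [IsBand M] (hd : d ∈ charDerivations χ ψ) {m : M}
    (h1 : χ m = 0) (h2 : ψ m = 0) : d m = 0 := by
  have h := hd m m
  rw [IsBand.mul_self, h1, h2] at h
  linear_combination h

theorem subsingleton_derivationClasses (h : charDerivations χ ψ ≤ innerDerivations χ ψ) :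
    Subsingleton (DerivationClasses χ ψ) := by
  rw [Submodule.Quotient.subsingleton_iff, Submodule.submoduleOf_eq_top]
  exact h

/-- Passing to the opposite monoid exchanges the two characters. -/
def charDerivationsOpEquiv {χ' ψ' : Mᵐᵒᵖ →* k} (hχ : ∀ m, χ' (MulOpposite.op m) = χ m)
    (hψ : ∀ m, ψ' (MulOpposite.op m) = ψ m) :
    charDerivations χ ψ ≃ₗ[k] charDerivations ψ' χ' where
  toFun d := ⟨fun m => d.1 m.unop, fun m n => by
    change d.1 (n.unop * m.unop) = χ' (MulOpposite.op m.unop) * _ +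
      _ * ψ' (MulOpposite.op n.unop)
    rw [d.2, hχ, hψ]
    ring⟩
  invFun d := ⟨fun m => d.1 (MulOpposite.op m), fun m n => by
    change d.1 (MulOpposite.op n * MulOpposite.op m) = _
    rw [d.2, hχ, hψ]
    ring⟩
  map_add' _ _ := rfl
  map_smul' _ _ := rfl
  left_inv _ := rfl
  right_inv _ := rfl

theorem rank_derivationClasses_op {χ' ψ' : Mᵐᵒᵖ →* k} (hχ : ∀ m, χ' (MulOpposite.op m) = χ m)
    (hψ : ∀ m, ψ' (MulOpposite.op m) = ψ m) :
    Module.rank k (DerivationClasses χ ψ) = Module.rank k (DerivationClasses ψ' χ') := by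
  refine (Submodule.Quotient.equiv _ _ (charDerivationsOpEquiv hχ hψ) ?_).rank_eq
  ext d
  simp only [Submodule.mem_map, Submodule.submoduleOf, Submodule.mem_comap, innerDerivations,
    Submodule.mem_span_singleton]
  constructor
  · rintro ⟨d', ⟨c, hc⟩, rfl⟩
    -- Swapping the characters turns ψ - χ into its negative.
    refine ⟨-c, ?_⟩
    ext m
    have h := congrFun hc m.unop
    change c * (ψ m.unop - χ m.unop) = d'.1 m.unop at h
    change -c * (χ' (MulOpposite.op m.unop) - ψ' (MulOpposite.op m.unop)) = d'.1 m.unop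
    rw [hχ, hψ, ← h]
    ring
  · rintro ⟨c, hc⟩
    refine ⟨(charDerivationsOpEquiv hχ hψ).symm d, ⟨-c, ?_⟩, by simp⟩
    ext m
    have h := congrFun hc (MulOpposite.op m)
    change c * (χ' (MulOpposite.op m) - ψ' (MulOpposite.op m)) = d.1 (MulOpposite.op m) at h
    change -c * (ψ m - χ m) = d.1 (MulOpposite.op m)
    rw [← h, hχ, hψ]
    ring

end Derivations

/-! ### Derivations on a band, and the classes of ≡. -/

section BandDerivations

variable {M : Type u} [Monoid M] [IsBand M] {k : Type v} [Field k]

theorem charDerivations_self_le (X : SupportLattice M) :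
    charDerivations (supportChar k X) (supportChar k X) ≤
      innerDerivations (supportChar k X) (supportChar k X) := by
  obtain ⟨x, rfl⟩ := exists_support_eq X
  intro d hd
  have : d = 0 := by
    ext m
    by_cases hm : x * m * x = x
    · exact charDerivations_apply_eq_zero_of_eq_one hd (supportChar_eq_one hm)
        (supportChar_eq_one hm)
    · exact charDerivations_apply_eq_zero_of_eq_zero hd (supportChar_eq_zero hm)
        (supportChar_eq_zero hm)
  rw [this]
  exact Submodule.zero_mem _

/-- Incomparability gives ψ(x) = 0 = χ(y). Evaluating d on mx expresses d(m) through d(mx) and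
ψ(m)d(x). Here d(mx) is d(x) or 0 according to χ(m), so in both cases d(m) = -d(x)(ψ(m) - χ(m)). -/
theorem charDerivations_le_of_incomparable {X Y : SupportLattice M} (hXY : ¬ X ≤ Y)
    (hYX : ¬ Y ≤ X) :
    charDerivations (supportChar k X) (supportChar k Y) ≤
      innerDerivations (supportChar k X) (supportChar k Y) := by
  obtain ⟨x, rfl⟩ := exists_support_eq X
  obtain ⟨y, rfl⟩ := exists_support_eq Y
  rw [support_le_support_iff] at hXY hYX
  intro d hd
  have hxx : supportChar k (support x) x = 1 :=
    supportChar_eq_one (by rw [IsBand.mul_self, IsBand.mul_self])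
  have hyx : supportChar k (support y) x = 0 := supportChar_eq_zero hYX
  have hxy : supportChar k (support x) y = 0 := supportChar_eq_zero hXY
  -- `d (m x)` in terms of `d m`
  have h1 : ∀ m, d m = d (m * x) - supportChar k (support y) m * d x := fun m => by
    rw [hd m x, hxx]
    ring
  -- `d` is constant on the `𝓙`-class of `x`
  have h2 : ∀ n, supportChar k (support x) n = 1 → supportChar k (support y) n = 0 →
      d n = - d y := by
    intro n hn hn'
    have h := hd y n
    rw [charDerivations_apply_eq_zero_of_eq_zero hd (m := y * n) (by rw [map_mul, hxy, zero_mul])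
      (by rw [map_mul, hn', mul_zero]), hn,
      supportChar_eq_one (by rw [IsBand.mul_self, IsBand.mul_self])] at h
    linear_combination -h
  refine Submodule.mem_span_singleton.2 ⟨- d x, ?_⟩
  ext m
  rw [Pi.smul_apply, smul_eq_mul, h1 m]
  by_cases hm : x * m * x = x
  · have hm' : supportChar k (support x) m = 1 := supportChar_eq_one hm
    rw [h2 (m * x) (by rw [map_mul, hm', hxx, mul_one]) (by rw [map_mul, hyx, mul_zero]),
      ← h2 x hxx hyx, hm']
    ring
  · have hm' : supportChar k (support x) m = 0 := supportChar_eq_zero hm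
    rw [charDerivations_apply_eq_zero_of_eq_zero hd (m := m * x)
      (by rw [map_mul, hm', zero_mul]) (by rw [map_mul, hyx, mul_zero]), hm']
    ring

theorem self_mem_LClass (e : M) : e ∈ LClass e :=
  mem_LClass_iff.2 ⟨IsBand.mul_self e, IsBand.mul_self e⟩

theorem mul_mem_LClass {e m x : M} (hm : e * m * e = e) (hx : x ∈ LClass e) : m * x ∈ LClass e := by
  rw [mem_LClass_iff] at hx ⊢
  obtain ⟨h1, h2⟩ := hx
  refine ⟨by rw [mul_assoc, h1], ?_⟩
  have h3 : e * (m * x) * e = e :=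
    mul_mul_mul_of_mul_mul_self hm (by rw [h2, IsBand.mul_self])
  calc e * (m * x) = e * (m * x) * e := by simp only [mul_assoc, h1]
    _ = e := h3

variable {eX eY : M}

/-- The class of `e_Y x` for `x` in the `𝓛`-class of `e_X`. -/
def EquivClasses.mk (eY : M) {eX x : M} (hx : x ∈ LClass eX) : EquivClasses eX eY :=
  Quotient.mk _ ⟨eY * x, x, hx, rfl⟩

theorem EquivClasses.mk_surjective (q : EquivClasses eX eY) :
    ∃ (x : M) (hx : x ∈ LClass eX), EquivClasses.mk eY hx = q := by
  obtain ⟨⟨z, x, hx, rfl⟩, rfl⟩ := Quotient.exists_rep q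
  exact ⟨x, hx, rfl⟩

theorem EquivClasses.mk_congr {x x' : M} (hx : x ∈ LClass eX) (hx' : x' ∈ LClass eX)
    (h : eY * x = eY * x') : EquivClasses.mk eY hx = EquivClasses.mk eY hx' :=
  congrArg (Quotient.mk _) (Subtype.ext h)

theorem EquivClasses.mk_mul {m x : M} (hX : eX * eY * eX = eX) (hm : eX * m * eX = eX)
    (hx : x ∈ LClass eX) :
    EquivClasses.mk eY (mul_mem_LClass hm hx) =
      EquivClasses.mk eY (mul_mem_LClass hm (mul_mem_LClass hX hx)) :=
  Quotient.sound (Relation.EqvGen.rel _ _ (Or.inl ⟨m, x, hx, support_le_support_iff.2 hm,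
    by simp only [mul_assoc], by simp only [mul_assoc]⟩))

/-- Relation (a) inserts e_Y after m, and then e_Y m e_Y = e_Y absorbs m. With the next lemma, m
acts on classes as ψ(m) dictates: trivially when ψ(m) = 1, by a constant map when ψ(m) = 0. -/
theorem EquivClasses.mk_mul_of_mul_mul_eq {m x : M} (hX : eX * eY * eX = eX)
    (hm : eX * m * eX = eX) (hmY : eY * m * eY = eY) (hx : x ∈ LClass eX) :
    EquivClasses.mk eY (mul_mem_LClass hm hx) = EquivClasses.mk eY hx := by
  rw [EquivClasses.mk_mul hX hm hx]
  apply EquivClasses.mk_congr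
  rw [← mul_assoc, ← mul_assoc, hmY]

/-- After (a), both elements are fixed by e = e_Y m e_Y, so (b) identifies them if X < σ(e). The
case σ(e) = X, excluded from (b), costs nothing since the two elements are then equal. -/
theorem EquivClasses.mk_mul_of_mul_mul_ne {m x x' : M} (hX : eX * eY * eX = eX)
    (hm : eX * m * eX = eX) (hmY : eY * m * eY ≠ eY) (hx : x ∈ LClass eX) (hx' : x' ∈ LClass eX) :
    EquivClasses.mk eY (mul_mem_LClass hm hx) = EquivClasses.mk eY (mul_mem_LClass hm hx') := by
  rw [EquivClasses.mk_mul hX hm hx, EquivClasses.mk_mul hX hm hx']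
  have he : eX * (eY * m * eY) * eX = eX :=
    mul_mul_mul_of_mul_mul_self (mul_mul_mul_of_mul_mul_self hX hm) hX
  have hee := IsBand.mul_self (eY * m * eY)
  rcases (support_le_support_iff.2 he).lt_or_eq with hlt | heq
  · refine Quotient.sound (Relation.EqvGen.rel _ _ (Or.inr ⟨eY * m * eY, ⟨m, rfl⟩, hmY, hlt, ?_, ?_⟩))
    · change eY * m * eY * (eY * (m * (eY * x))) = eY * (m * (eY * x))
      calc _ = (eY * m * (eY * eY) * m * eY) * x := by simp only [mul_assoc]
        _ = eY * m * eY * (eY * m * eY) * x := by simp only [mul_assoc]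
        _ = _ := by rw [hee]; simp only [mul_assoc]
    · change eY * m * eY * (eY * (m * (eY * x'))) = eY * (m * (eY * x'))
      calc _ = (eY * m * (eY * eY) * m * eY) * x' := by simp only [mul_assoc]
        _ = eY * m * eY * (eY * m * eY) * x' := by simp only [mul_assoc]
        _ = _ := by rw [hee]; simp only [mul_assoc]
  · -- both products are equal to `(e_Y m e_Y) e_X`
    have key : ∀ {z : M}, z ∈ LClass eX → eY * (m * (eY * z)) = eY * m * eY * eX := by
      intro z hz
      obtain ⟨h1, h2⟩ := mem_LClass_iff.1 hz
      have hz' : eX * z * eX = eX := by rw [h2, IsBand.mul_self]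
      have h3 : (eY * m * eY) * z * (eY * m * eY) = eY * m * eY :=
        support_le_support_iff.1 (heq ▸ support_le_support_iff.2 hz')
      have h4 : eY * (m * (eY * z)) = (eY * m * eY) * z := by simp only [mul_assoc]
      rw [h4]
      generalize eY * m * eY = e at he h3 ⊢
      calc e * z = e * z * (eX * e * eX) := by rw [he, mul_assoc, h1]
        _ = e * (z * eX) * e * eX := by simp only [mul_assoc]
        _ = e * eX := by rw [h1, h3]
    apply EquivClasses.mk_congr
    rw [key hx, key hx']

theorem charDerivations_mul_eq {eX eY : M} {d : M → k}
    (hd : d ∈ charDerivations (supportChar k (support eX)) (supportChar k (support eY)))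
    (hX : eX * eY * eX = eX) (m : M) : d (eY * m) = d m := by
  have hYY : eY * eY * eY = eY := by rw [IsBand.mul_self, IsBand.mul_self]
  rw [hd eY m, charDerivations_apply_eq_zero_of_eq_one hd (supportChar_eq_one hX)
    (supportChar_eq_one hYY), supportChar_eq_one hYY]
  ring

/-- For (a), expand both values: left multiplication by e_Y changes neither d nor χ. For (b), ψ(e) =
0 and χ(w) = 1 give d(w) = d(ew) = d(e) for every w fixed by e. -/
theorem charDerivations_generatingRel {d : M → k}
    (hd : d ∈ charDerivations (supportChar k (support eX)) (supportChar k (support eY)))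
    (hX : eX * eY * eX = eX) {z z' : translatedLClass eX eY} (h : generatingRel eX eY z z') :
    d z = d z' := by
  have hL : ∀ z : translatedLClass eX eY, supportChar k (support eX) z = 1 := by
    rintro ⟨_, x, hx, rfl⟩
    obtain ⟨h1, h2⟩ := mem_LClass_iff.1 hx
    rw [map_mul, supportChar_eq_one hX, one_mul]
    exact supportChar_eq_one (by rw [h2, IsBand.mul_self])
  rcases h with ⟨m, x, hx, hm, hz, hz'⟩ | ⟨e, ⟨m, rfl⟩, hne, -, hz, hz'⟩
  · rw [hz, hz', mul_assoc eY m eY, mul_assoc, mul_assoc, mul_assoc, charDerivations_mul_eq hd hX,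
      charDerivations_mul_eq hd hX, hd m, hd m, charDerivations_mul_eq hd hX, map_mul,
      supportChar_eq_one hX, one_mul]
  · have h0 : supportChar k (support eY) (eY * m * eY) = 0 := by
      refine supportChar_eq_zero fun h => hne ?_
      rwa [← mul_assoc, ← mul_assoc, IsBand.mul_self, mul_assoc, IsBand.mul_self] at h
    have key : ∀ w : translatedLClass eX eY, eY * m * eY * (w : M) = w →
        d w = d (eY * m * eY) := fun w hw => by
      rw [← hw, hd (eY * m * eY) w, h0, hL]
      ring
    rw [key z hz, key z' hz']

open Classical in
/-- The function on `M` that extends a function on the classes of `≡` to a derivation. -/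
noncomputable def derivationOfFunction (k : Type v) [Field k] (f : EquivClasses eX eY → k)
    (m : M) : k :=
  -- The formula is forced: χ(e_X) = 1, so d(m e_X) = ψ(m)d(e_X) + d(m). Off the up-set of X both
  -- characters vanish when X < Y, hence so must d.
  if hm : eX * m * eX = eX then
    f (EquivClasses.mk eY (mul_mem_LClass hm (self_mem_LClass eX))) -
      supportChar k (support eY) m * f (EquivClasses.mk eY (self_mem_LClass eX))
  else 0

theorem derivationOfFunction_pos (f : EquivClasses eX eY → k) {m : M} (hm : eX * m * eX = eX) :
    derivationOfFunction k f m =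
      f (EquivClasses.mk eY (mul_mem_LClass hm (self_mem_LClass eX))) -
      supportChar k (support eY) m * f (EquivClasses.mk eY (self_mem_LClass eX)) :=
  dif_pos hm

theorem derivationOfFunction_neg (f : EquivClasses eX eY → k) {m : M} (hm : eX * m * eX ≠ eX) :
    derivationOfFunction k f m = 0 :=
  dif_neg hm

theorem derivationOfFunction_mem (f : EquivClasses eX eY → k) (hlt : support eX < support eY) :
    derivationOfFunction k f ∈
      charDerivations (supportChar k (support eX)) (supportChar k (support eY)) := by
  have hXX := support_le_support_iff.1 hlt.le
  have hYX : ∀ {m : M}, eX * m * eX ≠ eX → supportChar k (support eY) m = 0 := fun {m} h =>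
    supportChar_eq_zero fun h' => h
      (support_le_support_iff.1 (hlt.le.trans (support_le_support_iff.2 h')))
  intro m n
  by_cases hmn : eX * (m * n) * eX = eX
  · have hm := mul_mul_left_of_mul_mul hmn
    have hn := mul_mul_right_of_mul_mul hmn
    have hmk : EquivClasses.mk eY (mul_mem_LClass hmn (self_mem_LClass eX)) =
        EquivClasses.mk eY (mul_mem_LClass hm (mul_mem_LClass hn (self_mem_LClass eX))) :=
      EquivClasses.mk_congr _ _ (by simp only [mul_assoc])
    rw [derivationOfFunction_pos f hmn, derivationOfFunction_pos f hm,
      derivationOfFunction_pos f hn, supportChar_eq_one (x := eX) hn, map_mul, hmk]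
    by_cases hmY : eY * m * eY = eY
    · rw [EquivClasses.mk_mul_of_mul_mul_eq hXX hm hmY (self_mem_LClass eX),
        EquivClasses.mk_mul_of_mul_mul_eq hXX hm hmY (mul_mem_LClass hn (self_mem_LClass eX)),
        supportChar_eq_one hmY]
      ring
    · rw [EquivClasses.mk_mul_of_mul_mul_ne hXX hm hmY (mul_mem_LClass hn (self_mem_LClass eX))
          (self_mem_LClass eX),
        supportChar_eq_zero hmY]
      ring
  · rw [derivationOfFunction_neg f hmn]
    by_cases hn : eX * n * eX = eX
    · have hm : eX * m * eX ≠ eX := fun hm => hmn (mul_mul_mul_of_mul_mul_self hm hn)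
      rw [derivationOfFunction_neg f hm, hYX hm]
      ring
    · rw [derivationOfFunction_neg f hn, supportChar_eq_zero (x := eX) hn]
      ring

/-- Derivations are the functions on the classes of the relation `≡` on `e_Y L_{e_X}`. -/
noncomputable def charDerivationsEquiv (k : Type v) [Field k] (hX' : eY * eX = eX)
    (hlt : support eX < support eY) :
    charDerivations (supportChar k (support eX)) (supportChar k (support eY)) ≃ₗ[k]
      (EquivClasses eX eY → k) where
  toFun d := Quotient.lift (fun z : translatedLClass eX eY => d.1 z) fun z z' h => by
    have hXX := support_le_support_iff.1 hlt.le
    induction h with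
    | rel _ _ h => exact charDerivations_generatingRel d.2 hXX h
    | refl _ => rfl
    | symm _ _ _ ih => exact ih.symm
    | trans _ _ _ _ _ ih ih' => exact ih.trans ih'
  map_add' d d' := by
    ext q
    obtain ⟨z, rfl⟩ := Quotient.exists_rep q
    rfl
  map_smul' c d := by
    ext q
    obtain ⟨z, rfl⟩ := Quotient.exists_rep q
    rfl
  invFun f := ⟨derivationOfFunction k f, derivationOfFunction_mem f hlt⟩
  left_inv d := by
    have hXX := support_le_support_iff.1 hlt.le
    ext m
    by_cases hm : eX * m * eX = eX
    · refine (derivationOfFunction_pos _ hm).trans ?_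
      change d.1 (eY * (m * eX)) - _ * d.1 (eY * eX) = d.1 m
      rw [charDerivations_mul_eq d.2 hXX, hX', d.2 m eX,
        supportChar_eq_one (x := eX) (m := eX) (by rw [IsBand.mul_self, IsBand.mul_self])]
      ring
    · exact (derivationOfFunction_neg _ hm).trans
        (charDerivations_apply_eq_zero_of_eq_zero d.2 (supportChar_eq_zero hm)
        (supportChar_eq_zero fun h' => hm
          (support_le_support_iff.1 (hlt.le.trans (support_le_support_iff.2 h'))))).symm
  right_inv f := by
    have hXX := support_le_support_iff.1 hlt.le
    ext q
    obtain ⟨x, hx, rfl⟩ := EquivClasses.mk_surjective q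
    obtain ⟨h1, h2⟩ := mem_LClass_iff.1 hx
    have hm : eX * (eY * x) * eX = eX :=
      mul_mul_mul_of_mul_mul_self hXX (by rw [h2, IsBand.mul_self])
    refine (derivationOfFunction_pos f hm).trans ?_
    -- The correction term disappears because σ(e_Y x) ≤ X < Y.
    rw [supportChar_eq_zero, zero_mul, sub_zero]
    · refine congrArg f (EquivClasses.mk_congr _ _ ?_)
      rw [mul_assoc, h1, ← mul_assoc, IsBand.mul_self]
    · intro h
      have h3 : support eY ≤ support x :=
        support_le_support_iff.2 (mul_mul_right_of_mul_mul h)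
      have h4 : support x ≤ support eX := by
        rw [← h1]
        exact principalIdeal_mul_left x eX
      exact hlt.not_ge (h3.trans h4)

theorem rank_derivationClasses [Finite M] (hX' : eY * eX = eX)
    (hlt : support eX < support eY) :
    Module.rank k (DerivationClasses (supportChar k (support eX)) (supportChar k (support eY))) =
      ((Nat.card (EquivClasses eX eY) - 1 : ℕ) : Cardinal) := by
  have : Finite (EquivClasses eX eY) := Quotient.finite _
  have := Fintype.ofFinite (EquivClasses eX eY)
  rw [← Module.finrank_eq_rank]
  congr 1
  have h := Submodule.finrank_quotient_add_finrank
    ((innerDerivations (supportChar k (support eX)) (supportChar k (support eY))).submoduleOf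
      (charDerivations (supportChar k (support eX)) (supportChar k (support eY))))
  rw [(charDerivationsEquiv k hX' hlt).finrank_eq, Module.finrank_pi,
    (Submodule.submoduleOfEquivOfLe (innerDerivations_le _ _)).finrank_eq, innerDerivations,
    finrank_span_singleton, ← Nat.card_eq_fintype_card] at h
  · exact Nat.eq_sub_of_add_eq h
  -- The spanning vector ψ - χ takes the value -1 at e_X, so the inner derivations have dimension
  -- exactly 1.
  · intro h0
    have h1 := congrFun h0 eX
    simp only [Pi.zero_apply] at h1
    rw [supportChar_eq_one (x := eX) (by rw [IsBand.mul_self, IsBand.mul_self]),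
      supportChar_eq_zero fun h' => hlt.not_ge (support_le_support_iff.2 h')] at h1
    simp at h1

end BandDerivations

/-! ### One-dimensional modules given by a character. -/

section CharGenerators

variable {k : Type v} [Field k] {A : Type w} [Ring A] [Algebra k A]

/-- The module `S` is one-dimensional over `k` with basis `s`, and `A` acts through `χ`. -/
structure IsCharGenerator (χ : A →ₐ[k] k) {S : Type*} [AddCommGroup S] [Module A S] (s : S) :
    Prop where
  ne_zero : s ≠ 0
  smul_eq : ∀ a : A, a • s = algebraMap k A (χ a) • s
  exists_smul_eq : ∀ w : S, ∃ c : k, algebraMap k A c • s = w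

namespace IsCharGenerator

variable {χ χ' : A →ₐ[k] k} {S T : Type*} [AddCommGroup S] [Module A S] [AddCommGroup T]
  [Module A T] {s s' : S} {t : T}

theorem algebraMap_smul_eq_zero_iff (hs : s ≠ 0) {c : k} :
    algebraMap k A c • s = 0 ↔ c = 0 := by
  refine ⟨fun h => by_contra fun hc => hs ?_, fun h => by rw [h, map_zero, zero_smul]⟩
  rw [← one_smul A s, ← map_one (algebraMap k A), ← inv_mul_cancel₀ hc, map_mul, mul_smul, h,
    smul_zero]

theorem algebraMap_smul_injective (h : IsCharGenerator χ s) :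
    Function.Injective fun c : k => algebraMap k A c • s := fun c c' hc => by
  have hc : algebraMap k A c • s = algebraMap k A c' • s := hc
  rwa [← sub_eq_zero, ← sub_smul, ← map_sub, algebraMap_smul_eq_zero_iff h.ne_zero,
    sub_eq_zero] at hc

theorem map (h : IsCharGenerator χ s) (e : S ≃ₗ[A] T) : IsCharGenerator χ (e s) where
  ne_zero := e.map_ne_zero_iff.2 h.ne_zero
  smul_eq a := by rw [← map_smul, h.smul_eq, map_smul]
  exists_smul_eq w := by
    obtain ⟨c, hc⟩ := h.exists_smul_eq (e.symm w)
    exact ⟨c, by rw [← map_smul, hc, e.apply_symm_apply]⟩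

/-- Scalars from k are central in A, so the action on the generator s determines the same character
on every vector. -/
theorem smul_eq_smul (h : IsCharGenerator χ s) (a : A) (w : S) :
    a • w = algebraMap k A (χ a) • w := by
  obtain ⟨c, rfl⟩ := h.exists_smul_eq w
  rw [← mul_smul, ← Algebra.commutes, mul_smul, h.smul_eq, ← mul_smul, ← mul_smul, ← map_mul,
    ← map_mul, mul_comm]

theorem char_unique (h : IsCharGenerator χ s) (h' : IsCharGenerator χ' s') : χ = χ' := by
  ext a
  exact h'.algebraMap_smul_injective ((h.smul_eq_smul a s').symm.trans (h'.smul_eq a))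

theorem smul_eq_zero_iff (h : IsCharGenerator χ s) {a : A} : a • s = 0 ↔ χ a = 0 := by
  rw [h.smul_eq, algebraMap_smul_eq_zero_iff h.ne_zero]

theorem toSpanSingleton_surjective (h : IsCharGenerator χ s) :
    Function.Surjective (LinearMap.toSpanSingleton A S s) := fun w => by
  obtain ⟨c, hc⟩ := h.exists_smul_eq w
  exact ⟨algebraMap k A c, hc⟩

/-- Both generators have annihilator ker χ, so both modules are A / ker χ. -/
theorem nonempty_linearEquiv (h : IsCharGenerator χ s) (h' : IsCharGenerator χ t) :
    Nonempty (S ≃ₗ[A] T) := by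
  have hk : (LinearMap.toSpanSingleton A S s).ker = (LinearMap.toSpanSingleton A T t).ker := by
    ext a
    rw [LinearMap.mem_ker, LinearMap.mem_ker, LinearMap.toSpanSingleton_apply,
      LinearMap.toSpanSingleton_apply, h.smul_eq_zero_iff, h'.smul_eq_zero_iff]
  exact ⟨((LinearMap.quotKerEquivOfSurjective _ h.toSpanSingleton_surjective).symm.trans
    (Submodule.quotEquivOfEq _ _ hk)).trans
      (LinearMap.quotKerEquivOfSurjective _ h'.toSpanSingleton_surjective)⟩

end IsCharGenerator

end CharGenerators

/-! ### Classification of the simple modules, and splitting. -/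

section SimpleModulesOfBands

variable {M : Type u} [Monoid M] {k : Type v} [Field k]

/-- The `k`-algebra homomorphism `kM → k` that extends the character `supportChar k X`. -/
noncomputable abbrev supportAlgHom (k : Type v) [Field k] (X : SupportLattice M) :
    MonoidAlgebra k M →ₐ[k] k :=
  MonoidAlgebra.lift k k M (supportChar k X)

theorem exists_isCharGenerator_supportModule (k : Type v) [Field k] (X : SupportLattice M) :
    ∃ s : supportModule k X, IsCharGenerator (supportAlgHom k X) s := by
  have hsmul : ∀ (a : MonoidAlgebra k M) (c : k),
      a • (show supportModule k X from (ULift.up c : ULift.{u} k)) =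
        (ULift.up (supportAlgHom k X a * c) : ULift.{u} k) := fun _ _ => rfl
  refine ⟨(ULift.up 1 : ULift.{u} k), ?_, fun a => ?_, fun w => ⟨(w : ULift.{u} k).down, ?_⟩⟩
  · intro h
    exact one_ne_zero (congrArg (ULift.down : ULift.{u} k → k) h)
  · refine (hsmul a 1).trans ((hsmul _ 1).trans ?_).symm
    rw [AlgHom.commutes]
    rfl
  · refine (hsmul _ 1).trans ?_
    rw [AlgHom.commutes, mul_one]
    rfl

open Classical in
/-- A simple module over the algebra of a finite band is one of the modules `S_X`. -/
theorem exists_isCharGenerator_of_isSimpleModule [Finite M] [IsBand M] {S : Type*}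
    [AddCommGroup S] [Module (MonoidAlgebra k M) S] [IsSimpleModule (MonoidAlgebra k M) S] :
    ∃ (X : SupportLattice M) (s : S), IsCharGenerator (supportAlgHom k X) s := by
  set of := MonoidAlgebra.of k M with hof
  have hS := IsSimpleModule.nontrivial (MonoidAlgebra k M) S
  obtain ⟨s₁, hs₁⟩ := exists_ne (0 : S)
  obtain ⟨x, ⟨s₀, hs₀⟩, hmin⟩ := exists_minimalFor_of_wellFoundedLT
    (fun m : M => ∃ s : S, of m • s ≠ 0) (fun m => support m) ⟨1, s₁, by rwa [map_one, one_smul]⟩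
  -- If m is not above x, then xm has strictly smaller support than x, so minimality makes it
  -- annihilate S.
  have hzero : ∀ m : M, x * m * x ≠ x → ∀ s : S, of (x * m) • s = 0 := fun m hm s => by
    by_contra h
    have h1 : support x ≤ support (x * m) := hmin ⟨s, h⟩ (principalIdeal_mul_right x m)
    exact hm (support_le_support_iff.1 (h1.trans (principalIdeal_mul_left x m)))
  have hzero' : ∀ m : M, x * m * x ≠ x → ∀ s : S, of (m * x) • s = 0 := fun m hm s => by
    by_contra h
    have h1 : support x ≤ support (m * x) := hmin ⟨s, h⟩ (principalIdeal_mul_left m x)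
    exact hm (support_le_support_iff.1 (h1.trans (principalIdeal_mul_right m x)))
  set s := of x • s₀ with hs
  have hxs : of x • s = s := by rw [hs, ← mul_smul, ← map_mul, IsBand.mul_self]
  -- the elements whose submodule is annihilated by `x`
  let N : Submodule (MonoidAlgebra k M) S :=
    { carrier := {w | ∀ a : MonoidAlgebra k M, of x • a • w = 0}
      zero_mem' := fun a => by rw [smul_zero, smul_zero]
      add_mem' := fun {w w'} h h' a => by rw [smul_add, smul_add, h a, h' a, add_zero]
      smul_mem' := fun c w h a => by rw [← mul_smul a c]; exact h (a * c) }
  have hN : N = ⊥ := by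
    refine (eq_bot_or_eq_top N).resolve_right fun h => hs₀ ?_
    have h1 : s ∈ N := h ▸ Submodule.mem_top
    have h2 := h1 1
    rwa [one_smul, hxs] at h2
  -- No xm separates ns from s = xs: if m is above x then xmnx = x = xmx, and otherwise xm
  -- annihilates S. So ns - s lies in N = 0.
  have hone : ∀ n : M, x * n * x = x → of n • s = s := fun n hn => by
    have h1 : of n • s - s ∈ N := fun a => by
      induction a using MonoidAlgebra.induction_on with
      | of m =>
        change of x • of m • (of n • s - s) = 0
        by_cases hm : x * m * x = x
        · have h2 := mul_mul_mul_of_mul_mul_self hm hn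
          rw [← hxs, smul_sub, smul_sub]
          simp only [← mul_smul, ← map_mul]
          rw [show x * (m * (n * x)) = x by simpa only [mul_assoc] using h2,
            show x * (m * x) = x by rw [← mul_assoc, hm], sub_self]
        · rw [← mul_smul, ← map_mul, hzero m hm]
      | add a b ha hb => rw [add_smul, smul_add, ha, hb, add_zero]
      | smul c a ha =>
        rw [Algebra.smul_def, mul_smul, ← mul_smul, ← Algebra.commutes, mul_smul, ha, smul_zero]
    rw [hN, Submodule.mem_bot, sub_eq_zero] at h1
    exact h1
  have hact : ∀ a : MonoidAlgebra k M,
      a • s = algebraMap k (MonoidAlgebra k M) (supportAlgHom k (support x) a) • s := fun a => by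
    induction a using MonoidAlgebra.induction_on with
    | of m =>
      rw [MonoidAlgebra.lift_of]
      by_cases hm : x * m * x = x
      · rw [supportChar_eq_one hm, map_one, one_smul]
        exact hone m hm
      · rw [supportChar_eq_zero hm, map_zero, zero_smul]
        change of m • s = 0
        rw [← hxs, ← mul_smul, ← map_mul, hzero' m hm]
    | add a b ha hb => rw [add_smul, ha, hb, map_add, map_add, add_smul]
    | smul c a ha => rw [map_smul, smul_eq_mul, map_mul, mul_smul, ← ha, Algebra.smul_def, mul_smul]
  refine ⟨support x, s, hs₀, hact, fun w => ?_⟩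
  obtain ⟨a, ha⟩ := IsSimpleModule.toSpanSingleton_surjective (MonoidAlgebra k M) hs₀ w
  exact ⟨supportAlgHom k (support x) a, (hact a).symm.trans ha⟩

theorem supportAlgHom_injective [IsBand M] :
    Function.Injective (supportAlgHom k : SupportLattice M → MonoidAlgebra k M →ₐ[k] k) :=
  (MonoidAlgebra.lift k k M).injective.comp (supportChar_injective k)

theorem vertex_bijective [Finite M] [IsBand M] :
    Function.Bijective
      (vertex k : SupportLattice M → GabrielQuiver k (MonoidAlgebra k M)) := by
  constructor
  · intro X Y h
    obtain ⟨e⟩ := Quotient.exact h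
    obtain ⟨s, hs⟩ := exists_isCharGenerator_supportModule k X
    obtain ⟨t, ht⟩ := exists_isCharGenerator_supportModule k Y
    exact supportAlgHom_injective ((hs.map e.toLinearEquiv).char_unique ht)
  · intro q
    obtain ⟨⟨S, hS⟩, rfl⟩ := Quotient.exists_rep q
    have := (simple_iff_isSimpleModule' S).1 hS
    obtain ⟨X, s, hs⟩ := exists_isCharGenerator_of_isSimpleModule (k := k) (M := M) (S := S)
    obtain ⟨t, ht⟩ := exists_isCharGenerator_supportModule k X
    obtain ⟨e⟩ := ht.nonempty_linearEquiv hs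
    exact ⟨X, Quotient.sound ⟨e.toModuleIso⟩⟩

/-- Arrows are defined with chosen representatives of isomorphism classes; this carries the
generator of S_X over to the chosen one. -/
theorem exists_isCharGenerator_out [IsBand M] (X : SupportLattice M) :
    ∃ s : (vertex k X).out.1, IsCharGenerator (supportAlgHom k X) s := by
  obtain ⟨e⟩ := Quotient.mk_out (s := simpleSetoid (MonoidAlgebra k M))
    ⟨supportModule k X, supportModule_simple k X⟩
  obtain ⟨s, hs⟩ := exists_isCharGenerator_supportModule k X
  exact ⟨_, hs.map e.symm.toLinearEquiv⟩

variable (k M) in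
/-- All the characters together. -/
noncomputable def supportAlgHomPi : MonoidAlgebra k M →ₐ[k] (SupportLattice M → k) :=
  AlgHom.pi fun X => supportAlgHom k X

/-- The image of x is the indicator of the Z ≤ σ(x). Induction on the finite order of supports
strips off the lower terms and leaves each coordinate vector. -/
theorem supportAlgHomPi_surjective [Finite M] [IsBand M] :
    Function.Surjective (supportAlgHomPi M k) := by
  classical
  have := Fintype.ofFinite (SupportLattice M)
  have hsingle : ∀ X : SupportLattice M,
      (Pi.single X 1 : SupportLattice M → k) ∈ (supportAlgHomPi M k).toLinearMap.range := by
    intro X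
    induction X using WellFoundedLT.induction with
    | ind X ih =>
      obtain ⟨x, rfl⟩ := exists_support_eq X
      have h1 : (Pi.single (support x) 1 : SupportLattice M → k) =
          (supportAlgHomPi M k).toLinearMap (MonoidAlgebra.of k M x) -
            ∑ Z with Z < support x, Pi.single Z 1 := by
        ext Z
        obtain ⟨z, rfl⟩ := exists_support_eq Z
        have h2 : (supportAlgHomPi M k).toLinearMap (MonoidAlgebra.of k M x) (support z) =
            supportChar k (support z) x := MonoidAlgebra.lift_of _ _
        rw [Pi.sub_apply, Finset.sum_apply, h2, supportChar_support, ← support_le_support_iff]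
        simp only [Pi.single_apply, Finset.sum_ite_eq, Finset.mem_filter, Finset.mem_univ, true_and]
        rcases eq_or_ne (support z) (support x) with h | h
        · simp [h]
        · simp [h, lt_iff_le_and_ne]
      rw [h1]
      exact Submodule.sub_mem _ ⟨_, rfl⟩
        (Submodule.sum_mem _ fun Z hZ => ih Z (Finset.mem_filter.1 hZ).2)
  suffices hrange : (supportAlgHomPi M k).toLinearMap.range = ⊤ from LinearMap.range_eq_top.1 hrange
  rw [eq_top_iff, ← (Pi.basisFun k (SupportLattice M)).span_eq, Submodule.span_le]
  rintro _ ⟨X, rfl⟩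
  rw [Pi.basisFun_apply]
  exact hsingle X

/-- Each character has a maximal kernel. Conversely, every simple quotient kM / I carries one of the
characters, so an element killed by all of them annihilates 1 + I. -/
theorem jacobson_eq_ker [Finite M] [IsBand M] :
    Ring.jacobson (MonoidAlgebra k M) = RingHom.ker (supportAlgHomPi M k) := by
  refine le_antisymm (fun a ha => ?_) fun a ha => ?_
  · rw [RingHom.mem_ker]
    ext X
    have hsurj : Function.Surjective (supportAlgHom k X) := fun c =>
      ⟨algebraMap k _ c, AlgHom.commutes _ _⟩
    have := RingHom.ker_isMaximal_of_surjective (supportAlgHom k X) hsurj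
    exact Ring.jacobson_le_of_isMaximal (RingHom.ker (supportAlgHom k X)) ha
  · rw [Ring.jacobson_eq_sInf_isMaximal, Submodule.mem_sInf]
    intro I hI
    have : IsSimpleModule (MonoidAlgebra k M) (MonoidAlgebra k M ⧸ I) :=
      isSimpleModule_iff_isCoatom.2 (Ideal.isMaximal_def.1 hI)
    obtain ⟨X, s, hs⟩ := exists_isCharGenerator_of_isSimpleModule (k := k) (M := M)
      (S := MonoidAlgebra k M ⧸ I)
    have h1 := hs.smul_eq_smul a (Submodule.Quotient.mk 1)
    have h2 : supportAlgHom k X a = 0 := congrFun ha X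
    rw [h2, map_zero, zero_smul, ← Submodule.Quotient.mk_smul, smul_eq_mul, mul_one] at h1
    exact (Submodule.Quotient.mk_eq_zero I).1 h1

theorem nonempty_algEquiv_matrix_one : Nonempty (k ≃ₐ[k] Matrix (Fin 1) (Fin 1) k) := by
  refine ⟨AlgEquiv.ofBijective (Algebra.ofId k _)
    ⟨(algebraMap k (Matrix (Fin 1) (Fin 1) k)).injective, fun A => ⟨A 0 0, ?_⟩⟩⟩
  ext i j
  rw [Subsingleton.elim i 0, Subsingleton.elim j 0]
  simp [Algebra.ofId_apply, Matrix.algebraMap_matrix_apply]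

theorem isSplitAlgebra_monoidAlgebra [Finite M] [IsBand M] :
    IsSplitAlgebra k (MonoidAlgebra k M) := by
  have e := Finite.equivFin (SupportLattice M)
  obtain ⟨f⟩ := nonempty_algEquiv_matrix_one (k := k)
  refine ⟨Nat.card (SupportLattice M), fun _ => 1, fun _ => one_pos, ⟨?_⟩⟩
  exact (Ideal.quotientEquivAlgOfEq k jacobson_eq_ker).trans
    ((Ideal.quotientKerAlgEquivOfSurjective supportAlgHomPi_surjective).trans
      ((AlgEquiv.piCongrLeft k (fun _ => k) e).trans
        (AlgEquiv.piCongrRight fun _ => f)))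

end SimpleModulesOfBands

/-! ### Ext¹ between characters as derivations modulo inner ones. -/

section Ext

open scoped ModuleCat

variable {M : Type u} [Monoid M] {k : Type v} [Field k]

/-- The linear extension of a function on `M` to `kM`. -/
noncomputable def linearExtension : (M → k) →ₗ[k] MonoidAlgebra k M →ₗ[k] k where
  toFun d := Finsupp.linearCombination k d ∘ₗ (MonoidAlgebra.coeffLinearEquiv k).toLinearMap
  map_add' d d' := by
    ext m
    simp
  map_smul' c d := by
    ext m
    simp

theorem linearExtension_of (d : M → k) (m : M) :
    linearExtension d (MonoidAlgebra.of k M m) = d m := by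
  simp [linearExtension]

theorem linearExtension_mul {χ ψ : M →* k} {d : M → k} (hd : d ∈ charDerivations χ ψ)
    (a b : MonoidAlgebra k M) :
    linearExtension d (a * b) = MonoidAlgebra.lift k k M ψ a * linearExtension d b +
      linearExtension d a * MonoidAlgebra.lift k k M χ b := by
  induction a using MonoidAlgebra.induction_on with
  | of m =>
    induction b using MonoidAlgebra.induction_on with
    | of n =>
      rw [← map_mul, linearExtension_of, linearExtension_of, linearExtension_of,
        MonoidAlgebra.lift_of, MonoidAlgebra.lift_of, hd m n]
    | add b b' hb hb' => rw [mul_add, map_add, hb, hb', map_add, map_add]; ring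
    | smul c b hb =>
      rw [mul_smul_comm, map_smul, hb, map_smul, map_smul]
      simp only [smul_eq_mul]
      ring
  | add a a' ha ha' => rw [add_mul, map_add, ha, ha', map_add, map_add]; ring
  | smul c a ha =>
    rw [smul_mul_assoc, map_smul, ha, map_smul, map_smul]
    simp only [smul_eq_mul]
    ring

variable {χ ψ : M →* k} {S T : ModuleCat.{max u v} (MonoidAlgebra k M)} {s : S} {t : T}

/-- The presentation `0 → K → kM → S → 0` of the module `S` with generator `s`. -/
noncomputable abbrev presentation (s : S) : ShortComplex (ModuleCat.{max u v} (MonoidAlgebra k M)) :=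
  (LinearMap.toSpanSingleton (MonoidAlgebra k M) S s).shortComplexKer

theorem presentation_shortExact (hs : IsCharGenerator (MonoidAlgebra.lift k k M χ) s) :
    (presentation s).ShortExact :=
  LinearMap.shortExact_shortComplexKer hs.toSpanSingleton_surjective

/-- The homomorphism `K → T` given by a derivation. -/
noncomputable def derivationHom (hs : IsCharGenerator (MonoidAlgebra.lift k k M χ) s)
    (ht : IsCharGenerator (MonoidAlgebra.lift k k M ψ) t) :
    charDerivations χ ψ →ₗ[k] ((presentation s).X₁ ⟶ T) where
  toFun d := ModuleCat.ofHom
    { toFun := fun a => algebraMap k (MonoidAlgebra k M) (linearExtension d.1 a.1) • t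
      map_add' := fun a b => by
        rw [Submodule.coe_add, map_add, map_add, add_smul]
      map_smul' := fun a b => by
        -- On K the term d(a)χ(b) vanishes, so the derivation rule becomes kM-linearity.
        have hb : MonoidAlgebra.lift k k M χ b.1 = 0 := hs.smul_eq_zero_iff.1 b.2
        rw [Submodule.coe_smul, smul_eq_mul, linearExtension_mul d.2, hb, mul_zero, add_zero,
          RingHom.id_apply, ht.smul_eq_smul a, ← mul_smul, map_mul] }
  map_add' d d' := by
    ext a
    change algebraMap k (MonoidAlgebra k M) (linearExtension (d.1 + d'.1) a.1) • t =
      algebraMap k (MonoidAlgebra k M) (linearExtension d.1 a.1) • t +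
        algebraMap k (MonoidAlgebra k M) (linearExtension d'.1 a.1) • t
    rw [map_add, LinearMap.add_apply, map_add, add_smul]
  map_smul' c d := by
    ext a
    change algebraMap k (MonoidAlgebra k M) (linearExtension (c • d.1) a.1) • t =
      algebraMap k (MonoidAlgebra k M) c •
        (algebraMap k (MonoidAlgebra k M) (linearExtension d.1 a.1) • t)
    rw [map_smul, LinearMap.smul_apply, smul_eq_mul, map_mul, mul_smul]

theorem derivationHom_apply (hs : IsCharGenerator (MonoidAlgebra.lift k k M χ) s)
    (ht : IsCharGenerator (MonoidAlgebra.lift k k M ψ) t) (d : charDerivations χ ψ)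
    (a : (LinearMap.toSpanSingleton (MonoidAlgebra k M) S s).ker) :
    (derivationHom hs ht d).hom a =
      algebraMap k (MonoidAlgebra k M) (linearExtension d.1 a.1) • t := rfl

/-- The element `a - χ(a)` of the kernel of the presentation. -/
noncomputable def kernelElement (hs : IsCharGenerator (MonoidAlgebra.lift k k M χ) s) :
    MonoidAlgebra k M →ₗ[k] (LinearMap.toSpanSingleton (MonoidAlgebra k M) S s).ker where
  toFun a := ⟨a - algebraMap k _ (MonoidAlgebra.lift k k M χ a), hs.smul_eq_zero_iff.2 (by
    have h : MonoidAlgebra.lift k k M χ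
        (a - algebraMap k _ (MonoidAlgebra.lift k k M χ a)) = 0 := by
      rw [map_sub, AlgHom.commutes, Algebra.algebraMap_self_apply, sub_self]
    exact h)⟩
  map_add' a b := Subtype.ext (by
    change a + b - _ = (a - _) + (b - _)
    rw [map_add, map_add]
    abel)
  map_smul' c a := Subtype.ext (by
    change c • a - _ = c • (a - _)
    rw [map_smul, smul_eq_mul, map_mul, smul_sub, ← Algebra.smul_def])

theorem coe_kernelElement (hs : IsCharGenerator (MonoidAlgebra.lift k k M χ) s)
    (a : MonoidAlgebra k M) :
    (kernelElement hs a).1 = a - algebraMap k _ (MonoidAlgebra.lift k k M χ a) := rfl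

theorem kernelElement_coe (hs : IsCharGenerator (MonoidAlgebra.lift k k M χ) s)
    (a : (LinearMap.toSpanSingleton (MonoidAlgebra k M) S s).ker) :
    kernelElement hs a.1 = a := Subtype.ext (by
  have ha : MonoidAlgebra.lift k k M χ a.1 = 0 := hs.smul_eq_zero_iff.1 a.2
  rw [coe_kernelElement, ha, map_zero, sub_zero])

/-- So a ↦ a - χ(a) itself obeys a derivation rule, which any homomorphism K → T transports to k. -/
theorem kernelElement_mul (hs : IsCharGenerator (MonoidAlgebra.lift k k M χ) s)
    (a b : MonoidAlgebra k M) :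
    kernelElement hs (a * b) = a • kernelElement hs b +
      MonoidAlgebra.lift k k M χ b • kernelElement hs a := Subtype.ext (by
  change a * b - _ = a * (b - _) + MonoidAlgebra.lift k k M χ b • (a - _)
  rw [map_mul, mul_comm (MonoidAlgebra.lift k k M χ a), map_mul, Algebra.smul_def, mul_sub, mul_sub,
    ← Algebra.commutes (MonoidAlgebra.lift k k M χ b) a]
  abel)

theorem derivationHom_kernelElement (hs : IsCharGenerator (MonoidAlgebra.lift k k M χ) s)
    (ht : IsCharGenerator (MonoidAlgebra.lift k k M ψ) t) (d : charDerivations χ ψ) (m : M) :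
    (derivationHom hs ht d).hom (kernelElement hs (MonoidAlgebra.of k M m)) =
      algebraMap k (MonoidAlgebra k M) (d.1 m) • t := by
  have h1 : d.1 1 = 0 := by
    have h := d.2 1 1
    rw [mul_one, map_one, map_one] at h
    linear_combination -h
  have h2 : linearExtension d.1 (1 : MonoidAlgebra k M) = 0 := by
    rw [← map_one (MonoidAlgebra.of k M), linearExtension_of, h1]
  have h3 : ∀ c : k, linearExtension d.1 (algebraMap k (MonoidAlgebra k M) c) = 0 := fun c => by
    rw [Algebra.algebraMap_eq_smul_one, map_smul, h2, smul_zero]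
  rw [derivationHom_apply, coe_kernelElement, map_sub (linearExtension d.1), h3, sub_zero,
    linearExtension_of]

/-- The map a ↦ a - χ(a) is a k-linear projection of kM onto K, so the images of the elements of M
span K. -/
theorem hom_eq_of_kernelElement (hs : IsCharGenerator (MonoidAlgebra.lift k k M χ) s)
    {f g : (presentation s).X₁ ⟶ T}
    (h : ∀ m, f.hom (kernelElement hs (MonoidAlgebra.of k M m)) =
      g.hom (kernelElement hs (MonoidAlgebra.of k M m))) : f = g := by
  have key : ∀ a : MonoidAlgebra k M,
      f.hom (kernelElement hs a) = g.hom (kernelElement hs a) := by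
    intro a
    induction a using MonoidAlgebra.induction_on with
    | of m => exact h m
    | add a b ha hb => rw [map_add, map_add, ha, hb, map_add]
    | smul c a ha =>
      have hc : kernelElement hs (c • a) =
          algebraMap k (MonoidAlgebra k M) c • kernelElement hs a := by
        rw [map_smul, algebraMap_smul]
      rw [hc, map_smul, ha, map_smul]
  ext a
  have := key a.1
  rwa [kernelElement_coe] at this

theorem derivationHom_surjective (hs : IsCharGenerator (MonoidAlgebra.lift k k M χ) s)
    (ht : IsCharGenerator (MonoidAlgebra.lift k k M ψ) t) :
    Function.Surjective (derivationHom hs ht) := by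
  intro f
  choose d hd using fun m : M =>
    ht.exists_smul_eq (f.hom (kernelElement hs (MonoidAlgebra.of k M m)))
  have hmem : d ∈ charDerivations χ ψ := fun m n => by
    apply ht.algebraMap_smul_injective
    change algebraMap k (MonoidAlgebra k M) _ • t = algebraMap k (MonoidAlgebra k M) _ • t
    rw [hd, map_mul (MonoidAlgebra.of k M), kernelElement_mul, map_add, map_smul, ← hd n,
      ← algebraMap_smul (MonoidAlgebra k M) (MonoidAlgebra.lift k k M χ _), map_smul, ← hd m,
      ht.smul_eq_smul (MonoidAlgebra.of k M m), ← mul_smul, ← mul_smul, ← map_mul, ← map_mul,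
      ← add_smul, ← map_add, MonoidAlgebra.lift_of, MonoidAlgebra.lift_of, mul_comm (d m)]
  exact ⟨⟨d, hmem⟩, hom_eq_of_kernelElement hs fun m => by
    rw [derivationHom_kernelElement, hd]⟩

/-- The class of extensions given by a derivation. -/
noncomputable def derivationExt (hs : IsCharGenerator (MonoidAlgebra.lift k k M χ) s)
    (ht : IsCharGenerator (MonoidAlgebra.lift k k M ψ) t) :
    charDerivations χ ψ →ₗ[k] Abelian.Ext.{max u v} S T 1 :=
  (Abelian.Ext.precompOfLinear (presentation_shortExact hs).extClass k T (add_zero 1)) ∘ₗ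
    (Abelian.Ext.linearEquiv₀ (R := k)).symm.toLinearMap ∘ₗ derivationHom hs ht

theorem derivationExt_apply (hs : IsCharGenerator (MonoidAlgebra.lift k k M χ) s)
    (ht : IsCharGenerator (MonoidAlgebra.lift k k M ψ) t) (d : charDerivations χ ψ) :
    derivationExt hs ht d = (presentation_shortExact hs).extClass.comp
      (Abelian.Ext.mk₀ (derivationHom hs ht d)) (add_zero 1) := rfl

theorem derivationExt_surjective (hs : IsCharGenerator (MonoidAlgebra.lift k k M χ) s)
    (ht : IsCharGenerator (MonoidAlgebra.lift k k M ψ) t) :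
    Function.Surjective (derivationExt hs ht) := by
  intro x
  have : Projective (presentation s).X₂ :=
    ModuleCat.projective_of_categoryTheory_projective (ModuleCat.of _ (MonoidAlgebra k M))
  obtain ⟨y, hy⟩ := precomp_extClass_surjective_of_projective_X₂ T (presentation_shortExact hs) 0 x
  obtain ⟨f, rfl⟩ := (Abelian.Ext.linearEquiv₀ (R := k)).symm.surjective y
  obtain ⟨d, rfl⟩ := derivationHom_surjective hs ht f
  exact ⟨d, hy⟩

/-- By exactness the kernel consists of the maps that extend to kM. An extension is determined by
the image ct of 1 and sends m - χ(m) to c(ψ(m) - χ(m))t. -/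
theorem ker_derivationExt (hs : IsCharGenerator (MonoidAlgebra.lift k k M χ) s)
    (ht : IsCharGenerator (MonoidAlgebra.lift k k M ψ) t) :
    (derivationExt hs ht).ker = (innerDerivations χ ψ).submoduleOf (charDerivations χ ψ) := by
  have hg : ∀ (g : (presentation s).X₂ ⟶ T) (c : k),
      g.hom (1 : MonoidAlgebra k M) = algebraMap k (MonoidAlgebra k M) c • t → ∀ m : M,
      ((presentation s).f ≫ g).hom (kernelElement hs (MonoidAlgebra.of k M m)) =
        algebraMap k (MonoidAlgebra k M) (c * (ψ m - χ m)) • t := by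
    intro g c hc m
    change g.hom (kernelElement hs (MonoidAlgebra.of k M m)).1 = _
    have h1 : (kernelElement hs (MonoidAlgebra.of k M m)).1 =
        (kernelElement hs (MonoidAlgebra.of k M m)).1 • (1 : MonoidAlgebra k M) :=
      (mul_one _).symm
    rw [h1]
    refine (map_smul g.hom _ _).trans ?_
    rw [hc, ht.smul_eq_smul, ← mul_smul, ← map_mul, coe_kernelElement, map_sub, AlgHom.commutes,
      MonoidAlgebra.lift_of, MonoidAlgebra.lift_of, mul_comm]
    rfl
  ext d
  rw [LinearMap.mem_ker, derivationExt_apply, Submodule.submoduleOf, Submodule.mem_comap,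
    innerDerivations, Submodule.mem_span_singleton]
  constructor
  · intro h
    obtain ⟨x, hx⟩ := Abelian.Ext.contravariant_sequence_exact₁ _ _ _ _ h
    obtain ⟨g, rfl⟩ := (Abelian.Ext.linearEquiv₀ (R := k)).symm.surjective x
    rw [Abelian.Ext.linearEquiv₀_symm_apply, Abelian.Ext.mk₀_comp_mk₀] at hx
    have hx' := (Abelian.Ext.linearEquiv₀ (R := k)).symm.injective hx
    obtain ⟨c, hc⟩ := ht.exists_smul_eq (g.hom (1 : MonoidAlgebra k M))
    refine ⟨c, funext fun m => ht.algebraMap_smul_injective ?_⟩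
    have h1 := hg g c hc.symm m
    rw [hx', derivationHom_kernelElement] at h1
    exact h1.symm
  · rintro ⟨c, hc⟩
    let g : (presentation s).X₂ ⟶ T := ModuleCat.ofHom
      (LinearMap.toSpanSingleton (MonoidAlgebra k M) T (algebraMap k (MonoidAlgebra k M) c • t))
    have h1 : derivationHom hs ht d = (presentation s).f ≫ g := by
      refine hom_eq_of_kernelElement hs fun m => ?_
      rw [derivationHom_kernelElement, hg g c (one_smul _ _)]
      exact congrArg (fun c => algebraMap k (MonoidAlgebra k M) c • t) (congrFun hc m).symm
    rw [h1, ← Abelian.Ext.mk₀_comp_mk₀]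
    exact (presentation_shortExact hs).extClass_comp_assoc _

theorem rank_ext (hs : IsCharGenerator (MonoidAlgebra.lift k k M χ) s)
    (ht : IsCharGenerator (MonoidAlgebra.lift k k M ψ) t) :
    Module.rank k (Abelian.Ext.{max u v} S T 1) = Module.rank k (DerivationClasses χ ψ) :=
  ((Submodule.quotEquivOfEq _ _ (ker_derivationExt hs ht).symm).trans
    (LinearMap.quotKerEquivOfSurjective _ (derivationExt_surjective hs ht))).rank_eq.symm

theorem mk_arrows [IsBand M] (X Y : SupportLattice M) :
    Cardinal.mk (vertex k X ⟶ vertex k Y) =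
      Module.rank k (DerivationClasses (supportChar k X) (supportChar k Y)) := by
  obtain ⟨s, hs⟩ := exists_isCharGenerator_out (k := k) X
  obtain ⟨t, ht⟩ := exists_isCharGenerator_out (k := k) Y
  rw [← rank_ext hs ht]
  exact (Module.Basis.ofVectorSpace k _).mk_eq_rank''

end Ext

/-! ### Supports and characters of the opposite monoid. -/

section OppositeMonoid

variable {M : Type u} [Monoid M]

theorem supportChar_op (k : Type v) [Field k] (X : SupportLattice M) (m : M) :
    supportChar k X.op (MulOpposite.op m) = supportChar k X m := by
  classical
  change ite _ _ _ = ite _ _ _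
  exact if_congr (op_mem_nup_iff X.1 m) rfl rfl

theorem SupportLattice.op_lt_op {X Y : SupportLattice M} (h : X < Y) : X.op < Y.op := by
  have hinj : Function.Surjective (MulOpposite.unop : Mᵐᵒᵖ → M) := fun m => ⟨MulOpposite.op m, rfl⟩
  rw [lt_iff_le_not_ge] at h ⊢
  exact ⟨Set.preimage_mono h.1, fun h' => h.2 ((Set.preimage_subset_preimage_iff
    (by rw [hinj.range_eq]; exact Set.subset_univ _)).1 h')⟩

theorem support_op [IsBand M] (m : M) :
    support (MulOpposite.op m) = (support m).op :=
  Subtype.ext (principalIdeal_op m)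

end OppositeMonoid

end BandQuiver

theorem mainTheorem10 (M : Type u) [Monoid M] [Finite M] [IsBand M] (k : Type v) [Field k] :
    -- the algebra splits over `k`, and `X ↦ [S_X]` identifies `Λ(M)` with the vertices of `Q(kM)`
    IsSplitAlgebra k (MonoidAlgebra k M) ∧
    Function.Bijective
      (vertex k : SupportLattice M → GabrielQuiver k (MonoidAlgebra k M)) ∧
    -- no arrows if `X` and `Y` are incomparable or equal
    (∀ X Y : SupportLattice M, ((¬ X ≤ Y ∧ ¬ Y ≤ X) ∨ X = Y) →
      IsEmpty (vertex k X ⟶ vertex k Y)) ∧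
    -- if `X < Y`, the generators can be chosen so that `e_X < e_Y`, for any generator `e_Y`
    (∀ X Y : SupportLattice M, X < Y →
      (∃ eY : M, support eY = Y) ∧
      ∀ eY : M, support eY = Y → ∃ eX : M, support eX = X ∧ IdemLT eX eY) ∧
    -- the number of arrows if `X < Y`
    (∀ X Y : SupportLattice M, X < Y →
      ∀ eX eY : M, support eX = X → support eY = Y → IdemLT eX eY →
        Cardinal.mk (vertex k X ⟶ vertex k Y) = ((Nat.card (EquivClasses eX eY) - 1 : ℕ) : Cardinal)) ∧
    -- the case `Y < X`, by passing to the opposite monoid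
    (∀ X Y : SupportLattice M, Y < X →
      Cardinal.mk (vertex k X ⟶ vertex k Y) = Cardinal.mk (vertex k Y.op ⟶ vertex k X.op) ∧
      ∀ eX eY : M, support eX = X → support eY = Y → IdemLT eY eX →
        Cardinal.mk (vertex k X ⟶ vertex k Y) =
          ((Nat.card (EquivClasses (MulOpposite.op eY) (MulOpposite.op eX)) - 1 : ℕ) :
            Cardinal)) := by
  have hempty : ∀ X Y : SupportLattice M,
      charDerivations (supportChar k X) (supportChar k Y) ≤
        innerDerivations (supportChar k X) (supportChar k Y) →
      IsEmpty (vertex k X ⟶ vertex k Y) := fun X Y h => by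
    have := subsingleton_derivationClasses h
    rw [← Cardinal.mk_eq_zero_iff, mk_arrows, rank_subsingleton']
  have hop : ∀ X Y : SupportLattice M,
      Cardinal.mk (vertex k X ⟶ vertex k Y) = Cardinal.mk (vertex k Y.op ⟶ vertex k X.op) :=
    fun X Y => by
      rw [mk_arrows, mk_arrows]
      exact rank_derivationClasses_op (supportChar_op k X) (supportChar_op k Y)
  refine ⟨isSplitAlgebra_monoidAlgebra, vertex_bijective, ?_, ?_, ?_, ?_⟩
  · rintro X Y (⟨hXY, hYX⟩ | rfl)
    · exact hempty X Y (charDerivations_le_of_incomparable hXY hYX)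
    · exact hempty X X (charDerivations_self_le X)
  · intro X Y h
    refine ⟨exists_support_eq Y, ?_⟩
    rintro eY rfl
    exact exists_idemLT h
  · rintro X Y h eX eY rfl rfl he
    rw [mk_arrows]
    exact rank_derivationClasses he.2.1 h
  · intro X Y h
    refine ⟨hop X Y, ?_⟩
    rintro eX eY rfl rfl he
    rw [hop, mk_arrows, ← support_op, ← support_op]
    have : Finite Mᵐᵒᵖ := Finite.of_equiv M MulOpposite.opEquiv
    -- Products reverse in the opposite monoid, so the other one-sided equation of e_Y < e_X is the
    -- one needed here.
    refine rank_derivationClasses (congrArg MulOpposite.op he.1) ?_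
    rw [support_op, support_op]
    exact SupportLattice.op_lt_op h
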